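/- Let $n\ge 2$ and let $H$ be a complex Hilbert space of dimension $n$. States are unit vectors of $H$. The input of a programmable discriminator for $n$ states $\psi_1,\dots,\psi_n$ of $H$ is $|\psi^n_j\rangle=|\psi_1\rangle\cdots|\psi_n\rangle|\psi_j\rangle\in H^{\otimes(n+1)}$: subsystems $1,\dots,n$ are the program registers, subsystem $n+1$ is the data register, which holds the state to be identified. An unambiguous programmable discriminator is a POVM $\Pi=(\Pi_0,\Pi_1,\dots,\Pi_n)$ on $H^{\otimes(n+1)}$ (positive operators with sum $I$) such that $\langle\psi^n_j|\Pi_i|\psi^n_j\rangle=0$ for all states $\psi_1,\dots,\psi_n$ and all $i\ne j$ in $\{1,\dots,n\}$. Its success probabilities are $p_i(\Pi;\psi)=\langle\psi^n_i|\Pi_i|\psi^n_i\rangle$, its efficiency is $p(\Pi)=\inf_{\psi}\min_i p_i(\Pi;\psi)$ over all families $\psi=(\psi_1,\dots,\psi_n)$ of linearly independent states, and, for the Gram matrix $X$, $X_{ij}=\langle\psi_i|\psi_j\rangle$, of such a family, $p_X(\Pi)$ denotes the same infimum over the families with Gram matrix $X$. Let $\Phi(n)$ be the orthogonal projector of $H^{\otimes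 n}$ onto its antisymmetric subspace $\wedge^nH$, let $I_i\otimes\Phi(n)_{\bar i}$ be the operator on $H^{\otimes(n+1)}$ that acts as the identity on subsystem $i$ and as $\Phi(n)$ on the other $n$ subsystems, and put $$\Pi^*_i=\frac{n}{n+1}\,I_i\otimes\Phi(n)_{\bar i}\quad(1\le i\le n),\qquad \Pi^*_0=I^{\otimes(n+1)}-\sum_{i=1}^n\Pi^*_i .$$ Then: 1. $\Pi^*$ is an unambiguous programmable discriminator. 2. For all states $\psi_1,\dots,\psi_n$ with Gram matrix $X$ and all $1\le i\le n$, $p_i(\Pi^*;\psi)=\dfrac{n}{(n+1)!}\det X$. 3. $\Pi^*$ is optimal in the minimax sense: $p(\Pi)\le p(\Pi^*)$ for every unambiguous programmable discriminator $\Pi$. Moreover, for every Gram matrix $X$ of $n$ linearly independent states, $p_X(\Pi)\le p_X(\Pi^*)$ for every unambiguous programmable discriminator $\Pi$, with equality only if $\Pi=\Pi^*$. -/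

import Mathlib

noncomputable section

namespace ProgDisc

open scoped ComplexOrder

variable {H : Type*} [NormedAddCommGroup H] [InnerProductSpace ℂ H] {m n k : ℕ}

/-- The `k`-fold tensor power of an `m`-dimensional Hilbert space, written in the product basis
`|ω⟩ = |ω₁⟩⋯|ω_k⟩` that an orthonormal basis `|1⟩, …, |m⟩` of the space induces. -/
abbrev Tens (m k : ℕ) : Type := EuclideanSpace ℂ (Fin k → Fin m)

/-- Operators on the `k`-fold tensor power, as matrices in the product basis. -/
abbrev TensOp (m k : ℕ) : Type := Matrix (Fin k → Fin m) (Fin k → Fin m) ℂ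

/-- The product vector `|x₁⟩|x₂⟩⋯|x_k⟩` of `H^{⊗k}`; its coordinate at `|ω⟩` is
`∏ l, ⟨ω_l|x_l⟩`. -/
def productVector (b : OrthonormalBasis (Fin m) ℂ H) (x : Fin k → H) : Tens m k :=
  WithLp.toLp 2 fun ω => ∏ l, inner ℂ (b (ω l)) (x l)

/-- The antisymmetric tensor product `|x₁⟩ ∧ |x₂⟩ ∧ ⋯ ∧ |x_k⟩`. -/
def wedge (b : OrthonormalBasis (Fin m) ℂ H) (x : Fin k → H) : Tens m k :=
  ((1 / Real.sqrt (k.factorial : ℝ) : ℝ) : ℂ) •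
    ∑ σ : Equiv.Perm (Fin k),
      (((Equiv.Perm.sign σ : ℤ) : ℂ)) • productVector b fun l => x (σ l)

/-- The antisymmetric subspace `∧^k H` of `H^{⊗k}`. -/
def antisymmetricSubspace (b : OrthonormalBasis (Fin m) ℂ H) (k : ℕ) :
    Submodule ℂ (Tens m k) :=
  Submodule.span ℂ (Set.range fun x : Fin k → H => wedge b x)

/-- The matrix of the orthogonal projector `Φ(k)` of `H^{⊗k}` onto `∧^k H`. -/
def antisymmetricProjector (b : OrthonormalBasis (Fin m) ℂ H) (k : ℕ) : TensOp m k :=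
  Matrix.of fun ω ω' =>
    ((antisymmetricSubspace b k).starProjection (EuclideanSpace.single ω' (1 : ℂ))) ω

/-- The operator `A_p ⊗ B_{p̄}` on `H^{⊗(k+1)}`: `A` acts on the subsystem `p`, and `B` acts on
the remaining `k` subsystems, taken in their order. -/
def tensorAt (p : Fin (k + 1)) (A : Matrix (Fin m) (Fin m) ℂ) (B : TensOp m k) :
    TensOp m (k + 1) :=
  Matrix.of fun ω ω' => A (ω p) (ω' p) * B (p.removeNth ω) (p.removeNth ω')

/-- The expectation `⟨v|A|v⟩`. -/
def expectation (v : Tens m k) (A : TensOp m k) : ℂ :=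
  star v.ofLp ⬝ᵥ A.mulVec v.ofLp

/-- A POVM with outcomes in `κ`: positive operators that sum to the identity. -/
structure IsPOVM {κ : Type*} [Fintype κ] (P : κ → TensOp m k) : Prop where
  posSemidef : ∀ a, (P a).PosSemidef
  sum_eq_one : ∑ a, P a = 1

/-- The total input `|ψ₁⟩⋯|ψ_n⟩|ψ_j⟩`: the program registers are the first `n` subsystems, and
the data register, which holds `|ψ_j⟩`, is the last one. -/
def inputState (b : OrthonormalBasis (Fin m) ℂ H) (ψ : Fin n → H) (j : Fin n) :
    Tens m (n + 1) :=
  productVector b (Fin.snoc (α := fun _ => H) ψ (ψ j))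

/-- `P 0, P 1, …, P n` is an unambiguous programmable discriminator for `n` states in `H`.
The outcome `0` is inconclusive; the `i`-th state is identified by the outcome `i.succ`, which
never occurs if the data register holds another state `|ψ_j⟩`, whatever the states are. -/
structure IsUnambiguousDiscriminator (b : OrthonormalBasis (Fin m) ℂ H)
    (P : Fin (n + 1) → TensOp m (n + 1)) : Prop where
  isPOVM : IsPOVM P
  noError : ∀ ψ : Fin n → H, (∀ i, ‖ψ i‖ = 1) →
    ∀ i j, i ≠ j → expectation (inputState b ψ j) (P i.succ) = 0

/-- The probability `p_i` of identifying the `i`-th of the states `ψ` (the expectation of a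
positive operator, hence a real number). -/
def successProb (b : OrthonormalBasis (Fin m) ℂ H) (P : Fin (n + 1) → TensOp m (n + 1))
    (ψ : Fin n → H) (i : Fin n) : ℝ :=
  (expectation (inputState b ψ i) (P i.succ)).re

/-- The worst-case success probability `inf_{ψ ∈ S} min_i p_i`. -/
def worstCaseOn (b : OrthonormalBasis (Fin m) ℂ H) (P : Fin (n + 1) → TensOp m (n + 1))
    (S : Set (Fin n → H)) : ℝ :=
  sInf {r : ℝ | ∃ ψ ∈ S, ∃ i, r = successProb b P ψ i}

/-- The families of `n` linearly independent (pure) states of `H`. -/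
def independentStates (H : Type*) [NormedAddCommGroup H] [InnerProductSpace ℂ H] (n : ℕ) :
    Set (Fin n → H) :=
  {ψ | (∀ i, ‖ψ i‖ = 1) ∧ LinearIndependent ℂ ψ}

/-- The families of `n` linearly independent states of `H` whose Gram matrix is `X`. -/
def statesWithGram (H : Type*) [NormedAddCommGroup H] [InnerProductSpace ℂ H]
    (X : Matrix (Fin n) (Fin n) ℂ) : Set (Fin n → H) :=
  {ψ | ψ ∈ independentStates H n ∧ Matrix.gram ℂ ψ = X}

/-- The minimax efficiency: the worst case over all linearly independent states. -/
def efficiency (b : OrthonormalBasis (Fin m) ℂ H) (P : Fin (n + 1) → TensOp m (n + 1)) : ℝ :=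
  worstCaseOn b P (independentStates H n)

/-- The measurement `Π_i = (n / (n + 1)) I_i ⊗ Φ(n)_{ī}` for `1 ≤ i ≤ n`, and
`Π_0 = I - ∑ i, Π_i`. -/
def optimalMeasurement (b : OrthonormalBasis (Fin m) ℂ H) (n : ℕ) :
    Fin (n + 1) → TensOp m (n + 1) :=
  let E : Fin n → TensOp m (n + 1) := fun i =>
    ((n : ℂ) / ((n : ℂ) + 1)) • tensorAt i.castSucc 1 (antisymmetricProjector b n)
  Fin.cons (1 - ∑ i, E i) E

end ProgDisc

end

noncomputable section

namespace ProgDisc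

open scoped ComplexOrder
open Matrix

variable {H : Type*} [NormedAddCommGroup H] [InnerProductSpace ℂ H] {m n k : ℕ}

/-! Since `dim H = n`, the space `∧^n H` is a line, spanned by the singlet. For each of the `n + 1`
subsystems `p`, let `V_p` (`slotIsometry p`) send `|k⟩` to `(-1)^p` times `|k⟩` in slot `p` and the
singlet elsewhere, so that `A_p ⊗ Φ = V_p A V_p†`. Expanding a determinant with two equal columns
gives `∑ V_p = 0`. With permutation symmetry this forces `V_p† V_q = -1/n` for `p ≠ q`, whence
`n/(n+1) ∑ V_p V_p†`, over all `n + 1` slots, is a projector. This makes `Π*_0` positive.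

Unambiguity is rigid (`exists_eq_tensorAt`): a positive operator with zero expectation kills the
vector, so each entry of `Π_i`, as a multilinear form, is alternating in all slots but `i`, and `Π_i
= V_i A_i V_i†` for some `A_i ≥ 0`. On the input with data `ψ_i` this has expectation `⟨ψ_i|A_i|ψ_i⟩
det X / n!`.

A unitary moves `ψ_i` to any unit vector without changing `X`, so the worst case over a Gram class
is bounded by every `⟨φ|A_i|φ⟩ det X / n!`. Testing `Π_0 ≥ 0` on `V_i|k⟩ - V_j|k⟩` bounds the sum of
the `k`-th diagonal entries of `A_i` and `A_j` by `2n/(n+1)` (`diag_add_diag_le`), which gives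
optimality. In case of equality every `A_i - n/(n+1)` is positive with trace zero, hence zero. -/

/-! ### Levi-Civita symbol and determinants -/

/-- The Levi-Civita symbol of a tuple `ω` of `n` indices in `Fin n`. -/
def leviCivita (ω : Fin n → Fin n) : ℂ :=
  ((1 : Matrix (Fin n) (Fin n) ℂ).submatrix ω id).det

theorem det_submatrix_left (a : Matrix (Fin n) (Fin n) ℂ) (ω : Fin n → Fin n) :
    (a.submatrix ω id).det = leviCivita ω * a.det := by
  rw [leviCivita, ← det_mul]
  congr 1
  ext i j
  simp [mul_apply, one_apply]

theorem det_submatrix_right (a : Matrix (Fin n) (Fin n) ℂ) (ω : Fin n → Fin n) :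
    (a.submatrix id ω).det = leviCivita ω * a.det := by
  rw [← det_transpose, transpose_submatrix, det_submatrix_left, det_transpose]

@[simp]
theorem leviCivita_perm (σ : Equiv.Perm (Fin n)) :
    leviCivita σ = ((Equiv.Perm.sign σ : ℤ) : ℂ) := by
  simp [leviCivita, det_permute]

@[simp]
theorem star_leviCivita (ω : Fin n → Fin n) : star (leviCivita ω) = leviCivita ω := by
  rw [leviCivita, ← det_conjTranspose, conjTranspose_submatrix, conjTranspose_one,
    ← det_transpose, transpose_submatrix, transpose_one]

theorem sum_leviCivita_mul_prod (a : Matrix (Fin n) (Fin n) ℂ) :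
    ∑ ω : Fin n → Fin n, leviCivita ω * ∏ l, a l (ω l) = a.det := by
  have h := (detRowAlternating (n := Fin n) (R := ℂ)).toMultilinearMap.map_sum
    (fun l k => a l k • Pi.single (M := fun _ => ℂ) k 1)
  have h1 : (fun l => ∑ k, a l k • Pi.single (M := fun _ => ℂ) k 1) = a := by
    ext l j
    simp [Finset.sum_apply, Pi.single_apply]
  rw [h1] at h
  refine Eq.trans ?_ h.symm
  refine Finset.sum_congr rfl fun ω _ => ?_
  rw [MultilinearMap.map_smul_univ, smul_eq_mul, mul_comm]
  congr 1
  change _ = det _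
  rw [leviCivita]
  congr 1
  ext i j
  simp [one_apply, Pi.single_apply, eq_comm]

theorem sum_leviCivita_mul_self :
    ∑ ω : Fin n → Fin n, leviCivita ω * leviCivita ω = (n.factorial : ℂ) := by
  have h : ∀ ω : Fin n → Fin n, leviCivita ω * leviCivita ω =
      ∑ σ : Equiv.Perm (Fin n), ((Equiv.Perm.sign σ : ℤ) : ℂ) *
        (leviCivita ω * ∏ l, (1 : Matrix (Fin n) (Fin n) ℂ).submatrix σ id l (ω l)) := by
    intro ω
    have hl : leviCivita ω = ∑ σ : Equiv.Perm (Fin n), ((Equiv.Perm.sign σ : ℤ) : ℂ) *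
        ∏ l, (1 : Matrix (Fin n) (Fin n) ℂ).submatrix σ id l (ω l) := by
      rw [leviCivita, ← det_transpose, det_apply']
      simp [one_apply, eq_comm]
    simp_rw [mul_left_comm _ (leviCivita ω), ← Finset.mul_sum, ← hl]
  simp_rw [h]
  rw [Finset.sum_comm]
  -- With one factor expanded over permutations, each inner sum is the determinant of a permutation
  -- matrix; the two signs cancel and `n!` terms equal to `1` remain.
  simp_rw [← Finset.mul_sum, sum_leviCivita_mul_prod, det_permute]
  have h2 : ∀ σ : Equiv.Perm (Fin n), ((Equiv.Perm.sign σ : ℤ) : ℂ) *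
      (((Equiv.Perm.sign σ : ℤ) : ℂ) * det (1 : Matrix (Fin n) (Fin n) ℂ)) = 1 := by
    intro σ
    rcases Int.units_eq_one_or (Equiv.Perm.sign σ) with h | h <;> simp [h]
  simp_rw [h2]
  simp [Fintype.card_perm]

/-! ### Coordinates and the antisymmetric line -/

/-- The coordinates of the vectors `x l`, as the rows of a matrix. -/
def coords (b : OrthonormalBasis (Fin m) ℂ H) (x : Fin k → H) : Matrix (Fin k) (Fin m) ℂ :=
  Matrix.of fun l i => inner ℂ (b i) (x l)

theorem coords_apply (b : OrthonormalBasis (Fin m) ℂ H) (x : Fin k → H) (l : Fin k) (i : Fin m) :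
    coords b x l i = inner ℂ (b i) (x l) := rfl

theorem coords_basis (b : OrthonormalBasis (Fin n) ℂ H) : coords b b = 1 := by
  ext l i
  rw [coords_apply, orthonormal_iff_ite.mp b.orthonormal, one_apply]
  simp [eq_comm]

theorem det_gram_eq (b : OrthonormalBasis (Fin n) ℂ H) (x : Fin n → H) :
    (gram ℂ x).det = star (coords b x).det * (coords b x).det := by
  have h : gram ℂ x = (coords b x).map star * (coords b x)ᵀ := by
    ext i j
    rw [gram_apply, ← b.sum_inner_mul_inner, mul_apply]
    simp [coords_apply]
  rw [h, det_mul, det_transpose, ← det_conjTranspose, ← det_transpose (_ᴴ)]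
  rfl

theorem productVector_apply (b : OrthonormalBasis (Fin m) ℂ H) (x : Fin k → H)
    (ω : Fin k → Fin m) : productVector b x ω = ∏ l, coords b x l (ω l) := rfl

/-- The unit vector that spans the antisymmetric subspace `∧^n H` if `dim H = n`. -/
def singlet (n : ℕ) : Tens n n :=
  WithLp.toLp 2 fun ω => ((1 / Real.sqrt (n.factorial : ℝ) : ℝ) : ℂ) * leviCivita ω

theorem singlet_apply (ω : Fin n → Fin n) :
    singlet n ω = ((1 / Real.sqrt (n.factorial : ℝ) : ℝ) : ℂ) * leviCivita ω := rfl

/-- Each coordinate of an `n`-fold wedge is a determinant of permuted columns of the coordinate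
matrix; this is where `∧^n H` becomes a line. -/
theorem wedge_eq (b : OrthonormalBasis (Fin n) ℂ H) (x : Fin n → H) :
    wedge b x = (coords b x).det • singlet n := by
  ext ω
  simp only [wedge, PiLp.smul_apply, smul_eq_mul, singlet_apply]
  have h : (∑ σ : Equiv.Perm (Fin n), (((Equiv.Perm.sign σ : ℤ) : ℂ)) •
      productVector b fun l => x (σ l)).ofLp ω = leviCivita ω * (coords b x).det := by
    rw [← det_submatrix_right, det_apply']
    simp [WithLp.ofLp_sum, Finset.sum_apply, productVector_apply, coords_apply]
  rw [h]
  ring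

theorem factor_sq : ((1 / Real.sqrt (n.factorial : ℝ) : ℝ) : ℂ) *
    ((1 / Real.sqrt (n.factorial : ℝ) : ℝ) : ℂ) = 1 / (n.factorial : ℂ) := by
  rw [← Complex.ofReal_mul, div_mul_div_comm, Real.mul_self_sqrt (by positivity)]
  simp

theorem norm_singlet : ‖singlet n‖ = 1 := by
  have h : inner ℂ (singlet n) (singlet n) = (1 : ℂ) := by
    rw [PiLp.inner_apply]
    have : ∀ ω : Fin n → Fin n, inner ℂ (singlet n ω) (singlet n ω) =
        1 / (n.factorial : ℂ) * (leviCivita ω * leviCivita ω) := by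
      intro ω
      rw [← factor_sq, singlet_apply, RCLike.inner_apply, map_mul, Complex.conj_ofReal,
        starRingEnd_apply, star_leviCivita]
      ring
    simp_rw [this]
    rw [← Finset.mul_sum, sum_leviCivita_mul_self]
    have : (n.factorial : ℂ) ≠ 0 := by exact_mod_cast n.factorial_ne_zero
    field_simp
  rw [inner_self_eq_norm_sq_to_K] at h
  have h' : ‖singlet n‖ ^ 2 = 1 := by
    apply Complex.ofReal_injective
    rw [Complex.ofReal_pow, Complex.ofReal_one]
    exact h
  exact (pow_eq_one_iff_of_nonneg (norm_nonneg _) two_ne_zero).mp h'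

theorem antisymmetricSubspace_eq (b : OrthonormalBasis (Fin n) ℂ H) :
    antisymmetricSubspace b n = ℂ ∙ singlet n := by
  apply le_antisymm
  · rw [antisymmetricSubspace, Submodule.span_le]
    rintro _ ⟨x, rfl⟩
    simp only [wedge_eq]
    exact Submodule.smul_mem _ _ (Submodule.mem_span_singleton_self _)
  · rw [Submodule.span_singleton_le_iff_mem]
    refine Submodule.subset_span ⟨b, ?_⟩
    simp only [wedge_eq, coords_basis, det_one, one_smul]

theorem antisymmetricProjector_apply (b : OrthonormalBasis (Fin n) ℂ H) (ω ω' : Fin n → Fin n) :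
    antisymmetricProjector b n ω ω' =
      1 / (n.factorial : ℂ) * (leviCivita ω * leviCivita ω') := by
  simp only [antisymmetricProjector, of_apply, antisymmetricSubspace_eq]
  rw [Submodule.starProjection_unit_singleton ℂ norm_singlet, EuclideanSpace.inner_single_right,
    PiLp.smul_apply, singlet_apply, singlet_apply, map_mul, Complex.conj_ofReal, starRingEnd_apply,
    star_leviCivita, ← factor_sq, smul_eq_mul]
  ring

/-! ### Expectations in product vectors, one subsystem split off -/

/-- Tuples of `k + 1` indices, with the `p`-th index split off. -/
theorem sum_eq_sum_insertNth {M : Type*} [AddCommMonoid M] (p : Fin (k + 1))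
    (f : (Fin (k + 1) → Fin m) → M) :
    ∑ ω, f ω = ∑ i : Fin m, ∑ η : Fin k → Fin m, f (p.insertNth i η) := by
  rw [← (Fin.insertNthEquiv (fun _ => Fin m) p).sum_comp, Fintype.sum_prod_type]
  rfl

theorem expectation_eq_sum (v : Tens m k) (A : TensOp m k) :
    expectation v A = ∑ ω, ∑ ω', star (v ω) * A ω ω' * v ω' := by
  simp only [expectation, dotProduct, mulVec, Pi.star_apply, Finset.mul_sum, mul_assoc]

theorem expectation_productVector_tensorAt (b : OrthonormalBasis (Fin m) ℂ H)
    (x : Fin (k + 1) → H) (p : Fin (k + 1)) (A : Matrix (Fin m) (Fin m) ℂ) (B : TensOp m k) :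
    expectation (productVector b x) (tensorAt p A B) =
      (star (coords b x p) ⬝ᵥ A *ᵥ coords b x p) *
        expectation (productVector b (p.removeNth x)) B := by
  have h : ∀ i η, productVector b x (p.insertNth i η) =
      coords b x p i * productVector b (p.removeNth x) η := by
    intro i η
    simp [productVector_apply, Fin.prod_univ_succAbove _ p, coords_apply, Fin.removeNth]
  have hA : star (coords b x p) ⬝ᵥ A *ᵥ coords b x p =
      ∑ i, ∑ j, star (coords b x p i) * (A i j * coords b x p j) := by
    simp only [dotProduct, mulVec, Finset.mul_sum, Pi.star_apply]
  rw [hA, expectation_eq_sum, expectation_eq_sum]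
  rw [sum_eq_sum_insertNth (M := ℂ) p]
  simp_rw [sum_eq_sum_insertNth (M := ℂ) p]
  simp only [h, tensorAt, of_apply, Fin.insertNth_apply_same, Fin.removeNth_insertNth]
  rw [Finset.sum_mul_sum]
  refine Finset.sum_congr rfl fun i _ => Finset.sum_congr rfl fun η _ => ?_
  rw [Finset.sum_mul_sum]
  refine Finset.sum_congr rfl fun j _ => Finset.sum_congr rfl fun η' _ => ?_
  rw [star_mul']
  ring

theorem expectation_antisymmetricProjector (b : OrthonormalBasis (Fin n) ℂ H) (x : Fin n → H) :
    expectation (productVector b x) (antisymmetricProjector b n) =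
      1 / (n.factorial : ℂ) * (star (coords b x).det * (coords b x).det) := by
  have h := sum_leviCivita_mul_prod (coords b x)
  have h' : star (coords b x).det =
      ∑ ω : Fin n → Fin n, leviCivita ω * star (productVector b x ω) := by
    simp only [← h, star_sum, star_mul', star_leviCivita, productVector_apply]
  rw [h', ← h, expectation_eq_sum, Finset.sum_mul_sum, Finset.mul_sum]
  refine Finset.sum_congr rfl fun ω _ => ?_
  rw [Finset.mul_sum]
  refine Finset.sum_congr rfl fun ω' _ => ?_
  rw [antisymmetricProjector_apply, productVector_apply b x ω']
  ring

/-! ### The slot isometries and their overlaps -/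

/-- The matrix whose row `r` consists of `c r` and the standard basis vector with index `ω r`. -/
def slotMatrix (c : Fin (n + 1) → ℂ) (ω : Fin (n + 1) → Fin n) :
    Matrix (Fin (n + 1)) (Fin (n + 1)) ℂ :=
  Matrix.of fun r => Fin.cons (c r) ((1 : Matrix (Fin n) (Fin n) ℂ) (ω r))

theorem det_slotMatrix (c : Fin (n + 1) → ℂ) (ω : Fin (n + 1) → Fin n) :
    (slotMatrix c ω).det = ∑ p : Fin (n + 1), (-1) ^ (p : ℕ) * c p * leviCivita (p.removeNth ω) := by
  rw [det_succ_column_zero]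
  refine Finset.sum_congr rfl fun p _ => ?_
  congr 1

/-- The columns of `slotIsometry p` are, up to the sign `(-1)^p`, the vectors with `|k⟩` in
the subsystem `p` and the singlet in the remaining ones. -/
def slotIsometry (p : Fin (n + 1)) : Matrix (Fin (n + 1) → Fin n) (Fin n) ℂ :=
  Matrix.of fun ω k => ((1 / Real.sqrt (n.factorial : ℝ) : ℝ) : ℂ) *
    (slotMatrix (fun r => if r = p then (1 : Matrix (Fin n) (Fin n) ℂ) (ω r) k else 0) ω).det

theorem slotIsometry_apply (p : Fin (n + 1)) (ω : Fin (n + 1) → Fin n) (k : Fin n) :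
    slotIsometry p ω k = ((1 / Real.sqrt (n.factorial : ℝ) : ℝ) : ℂ) *
      ((-1) ^ (p : ℕ) * (1 : Matrix (Fin n) (Fin n) ℂ) (ω p) k * leviCivita (p.removeNth ω)) := by
  simp only [slotIsometry, of_apply, det_slotMatrix]
  rw [Finset.sum_eq_single p]
  · simp
  · intro q _ hq
    simp [hq]
  · simp

theorem star_slotIsometry_apply (p : Fin (n + 1)) (ω : Fin (n + 1) → Fin n) (k : Fin n) :
    star (slotIsometry p ω k) = slotIsometry p ω k := by
  rw [slotIsometry_apply, star_mul', star_mul', star_mul', star_leviCivita, star_pow, star_neg,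
    star_one, one_apply]
  simp only [Complex.star_def, Complex.conj_ofReal, apply_ite (starRingEnd ℂ), map_one, map_zero]

/-- The entries are real, so transposes serve as adjoints below. -/
theorem conjTranspose_slotIsometry (p : Fin (n + 1)) :
    (slotIsometry p)ᴴ = (slotIsometry p)ᵀ := by
  ext k ω
  exact star_slotIsometry_apply p ω k

theorem sum_slotIsometry : ∑ p : Fin (n + 1), slotIsometry p = 0 := by
  ext ω k
  rw [Matrix.sum_apply, Matrix.zero_apply]
  -- Here column `0` coincides with the column of `k`; its Laplace expansion is the sum over the
  -- slots.
  have h : (slotMatrix (fun r => (1 : Matrix (Fin n) (Fin n) ℂ) (ω r) k) ω).det = 0 :=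
    det_zero_of_column_eq (Fin.succ_ne_zero k).symm fun r => by simp [slotMatrix]
  rw [det_slotMatrix] at h
  simp_rw [slotIsometry_apply]
  rw [← Finset.mul_sum, h, mul_zero]

/-- Permuting subsystems permutes the rows of `slotMatrix`. The sign `(-1)^p` built into the
isometry is what leaves only the sign of `σ`, independent of `p`. -/
theorem slotIsometry_perm (σ : Equiv.Perm (Fin (n + 1))) (p : Fin (n + 1))
    (ω : Fin (n + 1) → Fin n) (k : Fin n) :
    slotIsometry p (ω ∘ σ) k =
      ((Equiv.Perm.sign σ : ℤ) : ℂ) * slotIsometry (σ p) ω k := by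
  simp only [slotIsometry, of_apply]
  rw [mul_left_comm, ← det_permute]
  congr 2
  ext r s
  simp [slotMatrix]
  rfl

theorem slotIsometry_gram_perm (σ : Equiv.Perm (Fin (n + 1))) (p q : Fin (n + 1)) :
    (slotIsometry (σ p))ᵀ * slotIsometry (σ q) = (slotIsometry p)ᵀ * slotIsometry q := by
  ext k l
  simp only [mul_apply, transpose_apply]
  rw [← (Equiv.arrowCongr σ.symm (Equiv.refl (Fin n))).sum_comp
    fun ω => slotIsometry p ω k * slotIsometry q ω l]
  refine Finset.sum_congr rfl fun ω _ => ?_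
  have h : Equiv.arrowCongr σ.symm (Equiv.refl (Fin n)) ω = ω ∘ σ := rfl
  rw [h, slotIsometry_perm, slotIsometry_perm]
  rcases Int.units_eq_one_or (Equiv.Perm.sign σ) with h | h <;> simp [h]

theorem slotIsometry_gram_self (p : Fin (n + 1)) :
    (slotIsometry p)ᵀ * slotIsometry p = 1 := by
  ext k l
  simp only [mul_apply, transpose_apply]
  rw [sum_eq_sum_insertNth p]
  have h : ∀ (i : Fin n) (η : Fin n → Fin n),
      slotIsometry p (p.insertNth i η) k * slotIsometry p (p.insertNth i η) l =
      (1 / (n.factorial : ℂ) * ((1 : Matrix (Fin n) (Fin n) ℂ) i k *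
        (1 : Matrix (Fin n) (Fin n) ℂ) i l)) * (leviCivita η * leviCivita η) := by
    intro i η
    have hs : ((-1 : ℂ) ^ (p : ℕ)) * (-1) ^ (p : ℕ) = 1 := by rw [← mul_pow]; simp
    rw [slotIsometry_apply, slotIsometry_apply, Fin.insertNth_apply_same,
      Fin.removeNth_insertNth, ← factor_sq]
    linear_combination (((1 / Real.sqrt (n.factorial : ℝ) : ℝ) : ℂ) *
      ((1 / Real.sqrt (n.factorial : ℝ) : ℝ) : ℂ) * (1 : Matrix (Fin n) (Fin n) ℂ) i k *
        (1 : Matrix (Fin n) (Fin n) ℂ) i l * leviCivita η * leviCivita η) * hs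
  simp_rw [h]
  simp_rw [← Finset.mul_sum, sum_leviCivita_mul_self]
  have hn : (n.factorial : ℂ) ≠ 0 := by exact_mod_cast n.factorial_ne_zero
  have h1 : ∑ i, (1 : Matrix (Fin n) (Fin n) ℂ) i k * (1 : Matrix (Fin n) (Fin n) ℂ) i l =
      (1 : Matrix (Fin n) (Fin n) ℂ) k l := by
    have h2 := mul_apply (M := (1 : Matrix (Fin n) (Fin n) ℂ)ᵀ) (N := 1) (i := k) (k := l)
    rw [transpose_one, Matrix.mul_one] at h2
    rw [h2]
    simp only [one_apply, eq_comm]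
  rw [← Finset.sum_mul, ← Finset.mul_sum, h1]
  field_simp

/-- The overlap of the ranges of `slotIsometry p` and `slotIsometry q`. -/
def overlap (p q : Fin (n + 1)) : ℂ := if p = q then 1 else -1 / (n : ℂ)

/-- By permutation symmetry all products `V_pᵀ V_r` with `r ≠ p` agree; together with `V_pᵀ V_p = 1`
they sum to zero, so each of the `n` is `-1/n`. -/
theorem slotIsometry_gram (hn : n ≠ 0) (p q : Fin (n + 1)) :
    (slotIsometry p)ᵀ * slotIsometry q = overlap p q • 1 := by
  rw [overlap]
  split_ifs with hpq
  · rw [hpq, slotIsometry_gram_self, one_smul]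
  · have h : ∑ r : Fin (n + 1), (slotIsometry p)ᵀ * slotIsometry r = 0 := by
      rw [← Matrix.mul_sum, sum_slotIsometry, Matrix.mul_zero]
    rw [← Finset.add_sum_erase _ _ (Finset.mem_univ p), slotIsometry_gram_self,
      Finset.sum_congr rfl (g := fun _ => (slotIsometry p)ᵀ * slotIsometry q), Finset.sum_const,
      Finset.card_erase_of_mem (Finset.mem_univ p), Finset.card_univ, Fintype.card_fin,
      Nat.add_sub_cancel, ← Nat.cast_smul_eq_nsmul ℂ] at h
    · have hn' : (n : ℂ) ≠ 0 := by exact_mod_cast hn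
      have h2 : (n : ℂ) • ((slotIsometry p)ᵀ * slotIsometry q) = -1 := by
        rw [eq_neg_iff_add_eq_zero, add_comm, h]
      rw [div_eq_inv_mul, mul_smul, neg_one_smul, ← h2, smul_smul, inv_mul_cancel₀ hn', one_smul]
    · intro r hr
      have hrp : p ≠ r := (Finset.ne_of_mem_erase hr).symm
      -- The transposition of `q` and `r` fixes `p`.
      rw [← slotIsometry_gram_perm (Equiv.swap q r), Equiv.swap_apply_of_ne_of_ne hpq hrp,
        Equiv.swap_apply_right]

theorem tensorAt_eq (b : OrthonormalBasis (Fin n) ℂ H) (p : Fin (n + 1))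
    (A : Matrix (Fin n) (Fin n) ℂ) :
    tensorAt p A (antisymmetricProjector b n) = slotIsometry p * A * (slotIsometry p)ᵀ := by
  ext ω ω'
  have hs : ((-1 : ℂ) ^ (p : ℕ)) * (-1) ^ (p : ℕ) = 1 := by rw [← mul_pow]; simp
  have h : (1 : Matrix (Fin n) (Fin n) ℂ) * A * 1 = A := by simp
  rw [tensorAt, of_apply, antisymmetricProjector_apply]
  -- Writing `A` as `1 * A * 1` turns both sides into the same double sum, up to the squared sign.
  conv_lhs => rw [← h]
  simp only [mul_apply, transpose_apply, slotIsometry_apply, Finset.sum_mul]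
  refine Finset.sum_congr rfl fun i _ => Finset.sum_congr rfl fun j _ => ?_
  rw [← factor_sq, one_apply, one_apply, one_apply]
  simp only [@eq_comm _ i (ω' p)]
  linear_combination (-((1 / Real.sqrt (n.factorial : ℝ) : ℝ) : ℂ) *
      ((1 / Real.sqrt (n.factorial : ℝ) : ℝ) : ℂ) * (if ω p = j then 1 else 0) * A j i *
       (if ω' p = i then 1 else 0) * leviCivita (p.removeNth ω) * leviCivita (p.removeNth ω')) * hs

theorem posSemidef_tensorAt (b : OrthonormalBasis (Fin n) ℂ H) (p : Fin (n + 1))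
    {A : Matrix (Fin n) (Fin n) ℂ} (hA : A.PosSemidef) :
    (tensorAt p A (antisymmetricProjector b n)).PosSemidef := by
  rw [tensorAt_eq, ← conjTranspose_slotIsometry]
  exact hA.mul_mul_conjTranspose_same _

/-- The sum `Q` fixes the range of every slot isometry and is built from these ranges, so it is a
Hermitian idempotent. It includes the data slot `Fin.last n`, which the symmetry requires. -/
theorem posSemidef_one_sub_sum (hn : n ≠ 0) (b : OrthonormalBasis (Fin n) ℂ H) :
    (1 - ∑ p : Fin (n + 1), ((n : ℂ) / ((n : ℂ) + 1)) •
      tensorAt p 1 (antisymmetricProjector b n)).PosSemidef := by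
  set c : ℂ := (n : ℂ) / ((n : ℂ) + 1) with hc
  have hn' : (n : ℂ) ≠ 0 := by exact_mod_cast hn
  have hn1 : (n : ℂ) + 1 ≠ 0 := by exact_mod_cast n.succ_ne_zero
  set Q : TensOp n (n + 1) := ∑ p, c • tensorAt p 1 (antisymmetricProjector b n) with hQ
  have hH : Qᴴ = Q := by
    simp only [hQ, conjTranspose_sum, conjTranspose_smul]
    refine Finset.sum_congr rfl fun p _ => ?_
    rw [(posSemidef_tensorAt b p PosSemidef.one).isHermitian]
    congr 1
    simp [hc]
  have hS : ∀ q : Fin (n + 1), Q * slotIsometry q = slotIsometry q := by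
    intro q
    have h : ∀ p : Fin (n + 1), c • tensorAt p 1 (antisymmetricProjector b n) * slotIsometry q =
        (c * overlap p q) • slotIsometry p := by
      intro p
      rw [tensorAt_eq, Matrix.mul_one, smul_mul, Matrix.mul_assoc, slotIsometry_gram hn,
        Matrix.mul_smul, Matrix.mul_one, smul_smul]
    -- Isolates a constant multiple of `∑ V_p = 0`; the coefficient at `p = q` works because `c = 1
    -- - c / n`.
    have h2 : ∀ p : Fin (n + 1), (c * overlap p q) • slotIsometry p =
        (if p = q then slotIsometry q else 0) + (-c / n) • slotIsometry p := by
      intro p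
      rw [overlap]
      split_ifs with hpq
      · rw [hpq]
        nth_rw 2 [← one_smul ℂ (slotIsometry q)]
        rw [← add_smul]
        congr 1
        rw [hc]
        field_simp
        ring
      · rw [zero_add]
        congr 1
        ring
    rw [hQ, Matrix.sum_mul]
    simp_rw [h, h2]
    rw [Finset.sum_add_distrib, ← Finset.smul_sum, sum_slotIsometry]
    simp
  have hQQ : Q * Q = Q := by
    have hmul : Q * Q = ∑ p, Q * (c • tensorAt p 1 (antisymmetricProjector b n)) := by
      rw [← Matrix.mul_sum]
    rw [hmul]
    refine Finset.sum_congr rfl fun p _ => ?_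
    rw [tensorAt_eq, Matrix.mul_one, Matrix.mul_smul, ← Matrix.mul_assoc, hS]
  have : 1 - Q = (1 - Q) * (1 - Q)ᴴ := by
    rw [conjTranspose_sub, conjTranspose_one, hH, Matrix.sub_mul, Matrix.mul_sub, Matrix.mul_sub,
      hQQ]
    simp
  rw [this]
  exact posSemidef_self_mul_conjTranspose _

/-! ### Test vectors for the inconclusive outcome -/

/-- The difference of the vectors with `|k⟩` in the subsystem `p`, respectively `q`, and the
singlet elsewhere. -/
def slotDifference (p q : Fin (n + 1)) (k : Fin n) : (Fin (n + 1) → Fin n) → ℂ :=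
  slotIsometry p *ᵥ Pi.single k 1 - slotIsometry q *ᵥ Pi.single k 1

theorem transpose_mulVec_slotDifference (hn : n ≠ 0) (i p q : Fin (n + 1)) (k : Fin n) :
    (slotIsometry i)ᵀ *ᵥ slotDifference p q k =
      (overlap i p - overlap i q) • Pi.single k 1 := by
  rw [slotDifference, mulVec_sub, mulVec_mulVec, mulVec_mulVec, slotIsometry_gram hn,
    slotIsometry_gram hn, smul_mulVec, smul_mulVec, one_mulVec, sub_smul]

theorem star_slotDifference (p q : Fin (n + 1)) (k : Fin n) :
    star (slotDifference p q k) = slotDifference p q k := by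
  ext ω
  simp [slotDifference, star_slotIsometry_apply]

theorem slotDifference_dotProduct_self (hn : n ≠ 0) {p q : Fin (n + 1)} (hpq : p ≠ q)
    (k : Fin n) :
    star (slotDifference p q k) ⬝ᵥ slotDifference p q k = 2 * (1 + 1 / (n : ℂ)) := by
  rw [star_slotDifference]
  nth_rw 2 [slotDifference]
  rw [dotProduct_sub, dotProduct_mulVec, dotProduct_mulVec, ← mulVec_transpose,
    ← mulVec_transpose, transpose_mulVec_slotDifference hn, transpose_mulVec_slotDifference hn]
  simp [overlap, hpq, hpq.symm]
  ring

/-- The factor vanishes for `i` outside `{p, q}`, where the two overlaps agree: the test vector sees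
only two outcomes. -/
theorem slotDifference_tensorAt (hn : n ≠ 0) (b : OrthonormalBasis (Fin n) ℂ H)
    (i p q : Fin (n + 1)) (k : Fin n) (A : Matrix (Fin n) (Fin n) ℂ) :
    star (slotDifference p q k) ⬝ᵥ
      tensorAt i A (antisymmetricProjector b n) *ᵥ slotDifference p q k =
      (overlap i p - overlap i q) ^ 2 * A k k := by
  rw [star_slotDifference, tensorAt_eq, ← mulVec_mulVec, ← mulVec_mulVec,
    dotProduct_mulVec, ← mulVec_transpose, transpose_mulVec_slotDifference hn, mulVec_smul,
    smul_dotProduct, dotProduct_smul]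
  simp
  ring

/-! ### Rigidity of the conclusive outcomes -/

theorem map_comp_swap_of_eq_zero (f : MultilinearMap ℂ (fun _ : Fin k => H) ℂ) {p q : Fin k}
    (hpq : p ≠ q) (h : ∀ x : Fin k → H, x p = x q → f x = 0) (x : Fin k → H) :
    f (x ∘ Equiv.swap p q) = -f x := by
  have hself : ∀ y : H, f (Function.update (Function.update x p y) q y) = 0 := fun y =>
    h _ (by simp [hpq])
  have h0 := hself (x p + x q)
  rw [f.map_update_add, Function.update_comm hpq, Function.update_comm hpq,
    f.map_update_add, f.map_update_add, Function.update_comm hpq.symm, hself,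
    Function.update_comm hpq.symm _ (x q) x, Function.update_comm hpq.symm _ _ x,
    Function.update_comm hpq.symm (x q) (x q) x, hself,
    Function.update_eq_self, Function.update_eq_self, zero_add, add_zero] at h0
  rw [Equiv.comp_swap_eq_update, eq_neg_iff_add_eq_zero, Function.update_comm hpq.symm, h0]

/-- The coordinate at `η` of the image of a product vector, as a multilinear form. -/
def entryForm (b : OrthonormalBasis (Fin m) ℂ H) (M : TensOp m k) (η : Fin k → Fin m) :
    MultilinearMap ℂ (fun _ : Fin k => H) ℂ :=
  ∑ ω : Fin k → Fin m, M η ω •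
    (MultilinearMap.mkPiAlgebra ℂ (Fin k) ℂ).compLinearMap fun l => innerₛₗ ℂ (b (ω l))

theorem entryForm_apply (b : OrthonormalBasis (Fin m) ℂ H) (M : TensOp m k)
    (η : Fin k → Fin m) (x : Fin k → H) :
    entryForm b M η x = (M *ᵥ (productVector b x).ofLp) η := by
  simp [entryForm, mulVec, dotProduct, productVector]

theorem coords_comp (b : OrthonormalBasis (Fin n) ℂ H) (ω : Fin k → Fin n) :
    coords b (b ∘ ω) = (1 : Matrix (Fin n) (Fin n) ℂ).submatrix ω id := by
  rw [← coords_basis b]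
  rfl

theorem entryForm_basis (b : OrthonormalBasis (Fin m) ℂ H) (M : TensOp m k)
    (η ω : Fin k → Fin m) : entryForm b M η (b ∘ ω) = M η ω := by
  have h : (productVector b (b ∘ ω)).ofLp = Pi.single ω 1 := by
    ext ω'
    rw [productVector_apply, coords_comp]
    simp only [submatrix_apply]
    by_cases hω : ω' = ω
    · rw [hω, Pi.single_eq_same]
      exact Finset.prod_eq_one fun l _ => one_apply_eq _
    · obtain ⟨l, hl⟩ := Function.ne_iff.mp hω
      rw [Pi.single_eq_of_ne hω]
      exact Finset.prod_eq_zero (Finset.mem_univ l) (one_apply_ne hl.symm)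
  rw [entryForm_apply, h]
  simp

theorem exists_unit_smul (b : OrthonormalBasis (Fin n) ℂ H) (hn : n ≠ 0) (v : H) :
    ∃ (c : ℂ) (u : H), ‖u‖ = 1 ∧ v = c • u := by
  by_cases hv : v = 0
  · exact ⟨0, b ⟨0, Nat.pos_of_ne_zero hn⟩, b.orthonormal.1 _, by simp [hv]⟩
  · refine ⟨(‖v‖ : ℂ), (‖v‖ : ℂ)⁻¹ • v, ?_, ?_⟩
    · simp [norm_smul, hv]
    · rw [smul_smul, mul_inv_cancel₀, one_smul]
      simpa using hv

/-- Scaling to unit vectors turns `x` into an input with data state `j`. Zero expectation of a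
positive operator means that the operator annihilates the vector. -/
theorem entryForm_eq_zero (hn : n ≠ 0) (b : OrthonormalBasis (Fin n) ℂ H)
    {P : Fin (n + 1) → TensOp n (n + 1)} (hP : IsUnambiguousDiscriminator b P) {i j : Fin n}
    (hij : i ≠ j) (η : Fin (n + 1) → Fin n) {x : Fin (n + 1) → H}
    (hx : x j.castSucc = x (Fin.last n)) : entryForm b (P i.succ) η x = 0 := by
  -- The normalization is a function of the vector, so equal arguments in slots `j` and last stay
  -- equal.
  choose c u hu hc using exists_unit_smul b hn
  have h := hP.noError (fun l => u (x l.castSucc)) (fun l => hu _) i j hij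
  rw [expectation, (hP.isPOVM.posSemidef _).dotProduct_mulVec_zero_iff] at h
  have h' := congrFun h η
  have hx' : x = fun r => c (x r) • u (x r) := funext fun r => hc (x r)
  have hs : (Fin.snoc (α := fun _ => H) (fun l : Fin n => u (x l.castSucc)) (u (x j.castSucc))) =
      fun r => u (x r) := by
    ext r
    refine Fin.lastCases ?_ (fun l => ?_) r <;> simp [hx]
  rw [inputState, hs, ← entryForm_apply] at h'
  rw [hx', MultilinearMap.map_smul_univ, h', Pi.zero_apply, smul_zero]

/-- The no-error condition only compares a program register with the data register. For two program
registers, antisymmetry under swapping one of them with the data register reduces to that case. -/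
theorem entryForm_eq_zero_of_eq (hn : n ≠ 0) (b : OrthonormalBasis (Fin n) ℂ H)
    {P : Fin (n + 1) → TensOp n (n + 1)} (hP : IsUnambiguousDiscriminator b P) (i : Fin n)
    (η : Fin (n + 1) → Fin n) {x : Fin (n + 1) → H} {r s : Fin (n + 1)} (hrs : r ≠ s)
    (hr : r ≠ i.castSucc) (hs : s ≠ i.castSucc) (hx : x r = x s) :
    entryForm b (P i.succ) η x = 0 := by
  induction r using Fin.lastCases with
  | last =>
    induction s using Fin.lastCases with
    | last => exact absurd rfl hrs
    | cast s => exact entryForm_eq_zero hn b hP (fun h => hs (by rw [h])) η hx.symm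
  | cast r =>
    have hir : i ≠ r := fun h => hr (by rw [h])
    induction s using Fin.lastCases with
    | last => exact entryForm_eq_zero hn b hP hir η hx
    | cast s =>
      have his : i ≠ s := fun h => hs (by rw [h])
      rw [← neg_eq_zero, ← map_comp_swap_of_eq_zero _ (Fin.castSucc_lt_last r).ne
        fun y hy => entryForm_eq_zero hn b hP hir η hy]
      refine entryForm_eq_zero hn b hP his η ?_
      rw [Function.comp_apply, Function.comp_apply, Equiv.swap_apply_right,
        Equiv.swap_apply_of_ne_of_ne hrs.symm (Fin.castSucc_lt_last s).ne, hx]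

/-- With slot `i` frozen, the entry is an alternating form in `n` vectors of an `n`-dimensional
space, hence a multiple of the determinant. -/
theorem apply_eq_leviCivita_mul (hn : n ≠ 0) (b : OrthonormalBasis (Fin n) ℂ H)
    {P : Fin (n + 1) → TensOp n (n + 1)} (hP : IsUnambiguousDiscriminator b P) (i : Fin n)
    (η ω : Fin (n + 1) → Fin n) :
    P i.succ η ω = leviCivita (i.castSucc.removeNth ω) *
      P i.succ η (i.castSucc.insertNth (ω i.castSucc) id) := by
  set p := i.castSucc with hp
  let g : H [⋀^Fin n]→ₗ[ℂ] ℂ :=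
    { (entryForm b (P i.succ) η).curryMid p (b (ω p)) with
      map_eq_zero_of_eq' := fun z r s hz hrs => by
        refine entryForm_eq_zero_of_eq hn b hP i η (r := p.succAbove r) (s := p.succAbove s)
          (fun h => hrs (Fin.succAbove_right_injective h)) (Fin.succAbove_ne _ _)
          (Fin.succAbove_ne _ _) ?_
        rw [Fin.insertNth_apply_succAbove, Fin.insertNth_apply_succAbove, hz] }
  have hg : ∀ ζ : Fin n → Fin n, g (b ∘ ζ) = P i.succ η (p.insertNth (ω p) ζ) := by
    intro ζ
    refine Eq.trans ?_ (entryForm_basis b _ _ _)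
    change entryForm b (P i.succ) η (p.insertNth (b (ω p)) (b ∘ ζ)) = _
    congr 1
    ext r
    refine Fin.succAboveCases p ?_ (fun l => ?_) r <;> simp
  have hdet := congrArg (fun f => f (b ∘ p.removeNth ω)) (g.eq_smul_basis_det b.toBasis)
  have hmat : b.toBasis.det (b ∘ p.removeNth ω) = leviCivita (p.removeNth ω) := by
    rw [leviCivita, ← coords_comp b, ← det_transpose, Module.Basis.det_apply]
    congr 1
    ext r s
    simp [Module.Basis.toMatrix_apply, coords_apply, orthonormal_iff_ite.mp b.orthonormal]
  have hid := hg id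
  rw [Function.comp_id] at hid
  simp only [AlternatingMap.smul_apply, hmat, smul_eq_mul, OrthonormalBasis.coe_toBasis] at hdet
  rw [hg, hid, Fin.insertNth_self_removeNth] at hdet
  rw [hdet, mul_comm]

/-- A conclusive outcome `i` of an unambiguous discriminator acts as the antisymmetric projector
on all subsystems but `i`. -/
theorem exists_eq_tensorAt (hn : n ≠ 0) (b : OrthonormalBasis (Fin n) ℂ H)
    {P : Fin (n + 1) → TensOp n (n + 1)} (hP : IsUnambiguousDiscriminator b P) (i : Fin n) :
    ∃ A : Matrix (Fin n) (Fin n) ℂ, A.PosSemidef ∧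
      P i.succ = tensorAt i.castSucc A (antisymmetricProjector b n) := by
  have hM := hP.isPOVM.posSemidef i.succ
  -- The factor `n!` cancels the `1 / n!` in the entries of `Φ(n)`. The column identity and its
  -- adjoint then determine all entries.
  refine ⟨(n.factorial : ℂ) • (P i.succ).submatrix (fun k => i.castSucc.insertNth k id)
    (fun k => i.castSucc.insertNth k id), (hM.submatrix _).smul (by positivity), ?_⟩
  ext η ω
  have h1 := apply_eq_leviCivita_mul hn b hP i η ω
  have h2 := apply_eq_leviCivita_mul hn b hP i (i.castSucc.insertNth (ω i.castSucc) id) η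
  rw [← hM.isHermitian.apply] at h2
  have h3 := congrArg star h2
  rw [star_star, star_mul', star_leviCivita, hM.isHermitian.apply] at h3
  rw [h1, h3, tensorAt, of_apply, antisymmetricProjector_apply, Matrix.smul_apply, submatrix_apply,
    smul_eq_mul]
  have hn : (n.factorial : ℂ) ≠ 0 := by exact_mod_cast n.factorial_ne_zero
  field_simp

/-! ### Success and error probabilities -/

/-- Slot `j` and the data slot both lie outside slot `i` and hold the same vector, so the
determinant has two equal rows. -/
theorem expectation_inputState_of_ne (b : OrthonormalBasis (Fin n) ℂ H) (ψ : Fin n → H)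
    {i j : Fin n} (hij : i ≠ j) (A : Matrix (Fin n) (Fin n) ℂ) :
    expectation (inputState b ψ j) (tensorAt i.castSucc A (antisymmetricProjector b n)) = 0 := by
  rw [inputState, expectation_productVector_tensorAt, expectation_antisymmetricProjector]
  obtain ⟨r, hr⟩ := Fin.exists_succAbove_eq (x := j.castSucc) (y := i.castSucc)
    fun h => hij (Fin.castSucc_injective n h).symm
  obtain ⟨s, hs⟩ := Fin.exists_succAbove_eq (x := Fin.last n) (y := i.castSucc)
    (Fin.castSucc_lt_last i).ne'
  have hrs : r ≠ s := by
    rintro rfl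
    exact (Fin.castSucc_lt_last j).ne (hr.symm.trans hs)
  rw [det_zero_of_row_eq hrs]
  · simp
  · ext l
    simp [coords_apply, Fin.removeNth, hr, hs]

theorem expectation_inputState_self (b : OrthonormalBasis (Fin n) ℂ H) (ψ : Fin n → H)
    (i : Fin n) (A : Matrix (Fin n) (Fin n) ℂ) :
    expectation (inputState b ψ i) (tensorAt i.castSucc A (antisymmetricProjector b n)) =
      (star (coords b ψ i) ⬝ᵥ A *ᵥ coords b ψ i) *
        (1 / (n.factorial : ℂ) * (gram ℂ ψ).det) := by
  rw [inputState, expectation_productVector_tensorAt, expectation_antisymmetricProjector,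
    det_gram_eq b]
  -- The slots other than `i` hold all of `ψ`, with `ψ i` supplied by the data register; `t` is this
  -- reordering, and its sign enters squared.
  let t : Fin n → Fin n := fun a =>
    Fin.snoc (α := fun _ => Fin n) id i (i.castSucc.succAbove a)
  have ht : Function.Injective t := by
    have key : ∀ r s : Fin (n + 1), r ≠ i.castSucc → s ≠ i.castSucc →
        Fin.snoc (α := fun _ => Fin n) id i r = Fin.snoc (α := fun _ => Fin n) id i s → r = s := by
      intro r s hr hs h
      induction r using Fin.lastCases with
      | last =>
        induction s using Fin.lastCases with
        | last => rfl
        | cast s =>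
          simp only [Fin.snoc_last, Fin.snoc_castSucc, id] at h
          exact absurd (by rw [h]) hs
      | cast r =>
        induction s using Fin.lastCases with
        | last =>
          simp only [Fin.snoc_last, Fin.snoc_castSucc, id] at h
          exact absurd (by rw [h]) hr
        | cast s =>
          simp only [Fin.snoc_castSucc, id] at h
          rw [h]
    intro a c h
    exact Fin.succAbove_right_injective
      (key _ _ (Fin.succAbove_ne _ _) (Fin.succAbove_ne _ _) h)
  have hψ : (i.castSucc.removeNth (Fin.snoc (α := fun _ => H) ψ (ψ i)) : Fin n → H) = ψ ∘ t := by
    ext a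
    simp only [Fin.removeNth, Function.comp_apply, t]
    generalize i.castSucc.succAbove a = r
    refine Fin.lastCases ?_ (fun l => ?_) r <;> simp
  have hc : coords b (ψ ∘ t) = (coords b ψ).submatrix t id := rfl
  have hi : coords b (Fin.snoc (α := fun _ => H) ψ (ψ i)) i.castSucc = coords b ψ i := by
    ext l
    simp [coords_apply]
  have hl : leviCivita t * leviCivita t = 1 := by
    have hσ : leviCivita t = _ := leviCivita_perm (Equiv.ofBijective t
      (Finite.injective_iff_bijective.mp ht))
    rw [hσ]
    rcases Int.units_eq_one_or (Equiv.Perm.sign (Equiv.ofBijective t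
      (Finite.injective_iff_bijective.mp ht))) with h | h <;> simp [h]
  rw [hψ, hc, hi, det_submatrix_left, star_mul', star_leviCivita]
  linear_combination ((star (coords b ψ i) ⬝ᵥ A *ᵥ coords b ψ i) * (1 / (n.factorial : ℂ)) *
    star (coords b ψ).det * (coords b ψ).det) * hl

theorem optimalMeasurement_succ (b : OrthonormalBasis (Fin m) ℂ H) (n : ℕ) (i : Fin n) :
    optimalMeasurement b n i.succ = ((n : ℂ) / ((n : ℂ) + 1)) •
      tensorAt i.castSucc 1 (antisymmetricProjector b n) := rfl

theorem optimalMeasurement_zero (b : OrthonormalBasis (Fin m) ℂ H) (n : ℕ) :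
    optimalMeasurement b n 0 = 1 - ∑ i : Fin n, optimalMeasurement b n i.succ := rfl

theorem expectation_smul (v : Tens m k) (c : ℂ) (A : TensOp m k) :
    expectation v (c • A) = c * expectation v A := by
  simp [expectation, smul_mulVec]

theorem isUnambiguousDiscriminator_optimalMeasurement (hn : n ≠ 0)
    (b : OrthonormalBasis (Fin n) ℂ H) :
    IsUnambiguousDiscriminator b (optimalMeasurement b n) := by
  have hc : (0 : ℂ) ≤ (n : ℂ) / ((n : ℂ) + 1) := by
    have : ((n : ℂ) / ((n : ℂ) + 1)) = (((n : ℝ) / ((n : ℝ) + 1) : ℝ) : ℂ) := by push_cast; rfl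
    rw [this, Complex.zero_le_real]
    positivity
  refine ⟨⟨fun a => ?_, ?_⟩, fun ψ _ i j hij => ?_⟩
  · refine Fin.cases ?_ (fun i => ?_) a
    -- `Π*_0` is the complement of the symmetric sum plus the term of the data slot, which is not an
    -- outcome.
    · have h := (posSemidef_one_sub_sum hn b).add
        ((posSemidef_tensorAt b (Fin.last n) PosSemidef.one).smul hc)
      rw [Fin.sum_univ_castSucc, ← sub_sub, sub_add_cancel] at h
      exact h
    · exact (posSemidef_tensorAt b i.castSucc PosSemidef.one).smul hc
  · rw [Fin.sum_univ_succ, optimalMeasurement_zero, sub_add_cancel]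
  · rw [optimalMeasurement_succ, expectation_smul, expectation_inputState_of_ne b ψ hij, mul_zero]

theorem star_coords_dotProduct_self (b : OrthonormalBasis (Fin m) ℂ H) (ψ : Fin k → H)
    (i : Fin k) : star (coords b ψ i) ⬝ᵥ coords b ψ i = ((‖ψ i‖ ^ 2 : ℝ) : ℂ) := by
  have h := b.sum_inner_mul_inner (ψ i) (ψ i)
  rw [inner_self_eq_norm_sq_to_K] at h
  refine Eq.trans ?_ (h.trans (by push_cast; rfl))
  simp [dotProduct, coords_apply]

theorem successProb_optimalMeasurement (b : OrthonormalBasis (Fin n) ℂ H) {ψ : Fin n → H}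
    (hψ : ∀ i, ‖ψ i‖ = 1) (i : Fin n) :
    ((successProb b (optimalMeasurement b n) ψ i : ℝ) : ℂ) =
      (n : ℂ) / ((n + 1).factorial : ℂ) * (gram ℂ ψ).det := by
  have hn1 : (n : ℂ) + 1 ≠ 0 := by exact_mod_cast n.succ_ne_zero
  have hn : (n.factorial : ℂ) ≠ 0 := by exact_mod_cast n.factorial_ne_zero
  have h : expectation (inputState b ψ i) (optimalMeasurement b n i.succ) =
      (n : ℂ) / ((n + 1).factorial : ℂ) * (gram ℂ ψ).det := by
    rw [optimalMeasurement_succ, expectation_smul, expectation_inputState_self, one_mulVec,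
      star_coords_dotProduct_self, hψ, Nat.factorial_succ]
    push_cast
    field_simp
  have hr : (n : ℂ) / ((n + 1).factorial : ℂ) * (gram ℂ ψ).det =
      (((n : ℝ) / ((n + 1).factorial : ℝ) * Complex.normSq (coords b ψ).det : ℝ) : ℂ) := by
    rw [det_gram_eq b, Complex.star_def, ← Complex.normSq_eq_conj_mul_self]
    push_cast
    rfl
  rw [successProb, h, hr, Complex.ofReal_re]

/-! ### Worst case over a Gram class -/

/-- Unitaries preserve Gram matrices and act transitively on unit vectors: extend `ψ i` and `φ` to
orthonormal bases and map one basis to the other. -/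
theorem exists_mem_statesWithGram (b : OrthonormalBasis (Fin n) ℂ H) {ψ : Fin n → H}
    (hψ : ψ ∈ independentStates H n) (i : Fin n) {φ : H} (hφ : ‖φ‖ = 1) :
    ∃ ψ' ∈ statesWithGram H (gram ℂ ψ), ψ' i = φ := by
  have hfr : Module.finrank ℂ H = Fintype.card (Fin n) := Module.finrank_eq_card_basis b.toBasis
  have : FiniteDimensional ℂ H := b.toBasis.finiteDimensional_of_finite
  have key : ∀ v : H, ‖v‖ = 1 → ∃ e : OrthonormalBasis (Fin n) ℂ H, e i = v := by
    intro v hv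
    have ho : Orthonormal ℂ (({i} : Set (Fin n)).domRestrict fun _ : Fin n => v) :=
      ⟨fun _ => hv, fun r s hrs => absurd (Subsingleton.elim r s) hrs⟩
    obtain ⟨e, he⟩ := ho.exists_orthonormalBasis_extension_of_card_eq hfr
    exact ⟨e, he i rfl⟩
  obtain ⟨e₁, h₁⟩ := key (ψ i) (hψ.1 i)
  obtain ⟨e₂, h₂⟩ := key φ hφ
  let U : H ≃ₗᵢ[ℂ] H := e₁.equiv e₂ (Equiv.refl _)
  refine ⟨fun l => U (ψ l), ⟨⟨fun l => ?_, ?_⟩, ?_⟩, ?_⟩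
  · rw [U.norm_map, hψ.1]
  · exact hψ.2.map' U.toLinearEquiv.toLinearMap U.toLinearEquiv.ker
  · ext r s
    rw [gram_apply, gram_apply, U.inner_map_map]
  · simp only [U, ← h₁, OrthonormalBasis.equiv_apply_basis, Equiv.refl_apply, h₂]

theorem successProb_nonneg (b : OrthonormalBasis (Fin n) ℂ H)
    {P : Fin (n + 1) → TensOp n (n + 1)} (hP : IsUnambiguousDiscriminator b P) (ψ : Fin n → H)
    (i : Fin n) : 0 ≤ successProb b P ψ i :=
  (Complex.le_def.mp ((hP.isPOVM.posSemidef i.succ).dotProduct_mulVec_nonneg _)).1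

/-- Needed because the real `sInf` takes the default value `0` on sets unbounded below. -/
theorem bddBelow_successProb (b : OrthonormalBasis (Fin n) ℂ H)
    {P : Fin (n + 1) → TensOp n (n + 1)} (hP : IsUnambiguousDiscriminator b P)
    (S : Set (Fin n → H)) : BddBelow {r : ℝ | ∃ ψ ∈ S, ∃ i, r = successProb b P ψ i} :=
  ⟨0, by rintro _ ⟨ψ, _, i, rfl⟩; exact successProb_nonneg b hP ψ i⟩

theorem worstCaseOn_optimalMeasurement (b : OrthonormalBasis (Fin n) ℂ H)
    {ψ : Fin n → H} (hψ : ψ ∈ independentStates H n) (i : Fin n) :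
    worstCaseOn b (optimalMeasurement b n) (statesWithGram H (gram ℂ ψ)) =
      successProb b (optimalMeasurement b n) ψ i := by
  have h : {r : ℝ | ∃ ψ' ∈ statesWithGram H (gram ℂ ψ), ∃ i,
      r = successProb b (optimalMeasurement b n) ψ' i} =
      {successProb b (optimalMeasurement b n) ψ i} := by
    ext r
    constructor
    · rintro ⟨ψ', hψ', j, rfl⟩
      apply Complex.ofReal_injective
      rw [successProb_optimalMeasurement b hψ'.1.1, successProb_optimalMeasurement b hψ.1, hψ'.2]
    · rintro rfl
      exact ⟨ψ, ⟨hψ, rfl⟩, i, rfl⟩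
  rw [worstCaseOn, h, csInf_singleton]

/-! ### Optimality and uniqueness -/

/-- The constraint that the inconclusive outcome puts on two conclusive ones. -/
theorem diag_add_diag_le (hn : n ≠ 0) (b : OrthonormalBasis (Fin n) ℂ H)
    {P : Fin (n + 1) → TensOp n (n + 1)} (hP : IsPOVM P)
    {A : Fin n → Matrix (Fin n) (Fin n) ℂ}
    (hA : ∀ i, P i.succ = tensorAt i.castSucc (A i) (antisymmetricProjector b n))
    {i j : Fin n} (hij : i ≠ j) (k : Fin n) :
    (A i k k).re + (A j k k).re ≤ 2 * ((n : ℝ) / ((n : ℝ) + 1)) := by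
  have hij' : i.castSucc ≠ j.castSucc := fun h => hij (Fin.castSucc_injective n h)
  set v := slotDifference i.castSucc j.castSucc k with hv
  have h0 : P 0 = 1 - ∑ l : Fin n, P l.succ := by
    rw [← hP.sum_eq_one, Fin.sum_univ_succ, add_sub_cancel_right]
  have hpos := (hP.posSemidef 0).dotProduct_mulVec_nonneg v
  have hsum : star v ⬝ᵥ (∑ l : Fin n, P l.succ) *ᵥ v =
      (1 + 1 / (n : ℂ)) ^ 2 * (A i k k + A j k k) := by
    rw [sum_mulVec, dotProduct_sum, Fintype.sum_eq_add i j hij]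
    · rw [hA, hA, hv, slotDifference_tensorAt hn, slotDifference_tensorAt hn]
      simp only [overlap, hij', hij'.symm, if_true, if_false]
      ring
    · rintro l ⟨hli, hlj⟩
      have hli' : l.castSucc ≠ i.castSucc := fun h => hli (Fin.castSucc_injective n h)
      have hlj' : l.castSucc ≠ j.castSucc := fun h => hlj (Fin.castSucc_injective n h)
      rw [hA, hv, slotDifference_tensorAt hn]
      simp [overlap, hli', hlj']
  rw [h0, sub_mulVec, one_mulVec, dotProduct_sub, hsum, hv,
    slotDifference_dotProduct_self hn hij'] at hpos
  have hre : 2 * (1 + 1 / (n : ℂ)) - (1 + 1 / (n : ℂ)) ^ 2 * (A i k k + A j k k) =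
      ((2 * (1 + 1 / (n : ℝ)) : ℝ) : ℂ) -
        (((1 + 1 / (n : ℝ)) ^ 2 : ℝ) : ℂ) * (A i k k + A j k k) := by
    push_cast
    rfl
  rw [hre] at hpos
  have h := (Complex.le_def.mp hpos).1
  rw [Complex.sub_re, Complex.re_ofReal_mul, Complex.ofReal_re, Complex.zero_re,
    Complex.add_re] at h
  have hn0 : (0 : ℝ) < n := by exact_mod_cast Nat.pos_of_ne_zero hn
  have hx : (0 : ℝ) < 1 + 1 / (n : ℝ) := by positivity
  have hc : (n : ℝ) / ((n : ℝ) + 1) = (1 + 1 / (n : ℝ))⁻¹ := by field_simp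
  rw [hc, ← div_eq_mul_inv, le_div_iff₀ hx]
  -- Positivity of `P 0` reads `(1 + 1/n)² (a + a') ≤ 2 (1 + 1/n)` for the two diagonal entries; one
  -- factor cancels.
  refine le_of_mul_le_mul_left ?_ hx
  linarith

theorem worstCaseOn_le_mul (b : OrthonormalBasis (Fin n) ℂ H)
    {P : Fin (n + 1) → TensOp n (n + 1)} (hP : IsUnambiguousDiscriminator b P)
    {ψ : Fin n → H} (hψ : ψ ∈ independentStates H n) {i : Fin n} {A : Matrix (Fin n) (Fin n) ℂ}
    (hA : P i.succ = tensorAt i.castSucc A (antisymmetricProjector b n)) {φ : H}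
    (hφ : ‖φ‖ = 1) :
    worstCaseOn b P (statesWithGram H (gram ℂ ψ)) ≤
      (star (fun l => inner ℂ (b l) φ) ⬝ᵥ A *ᵥ fun l => inner ℂ (b l) φ).re *
        (Complex.normSq (coords b ψ).det / n.factorial) := by
  obtain ⟨ψ', hψ', hi⟩ := exists_mem_statesWithGram b hψ i hφ
  refine (csInf_le (bddBelow_successProb b hP _) ⟨ψ', hψ', i, rfl⟩).trans (le_of_eq ?_)
  have hd : 1 / (n.factorial : ℂ) * (gram ℂ ψ).det =
      ((Complex.normSq (coords b ψ).det / n.factorial : ℝ) : ℂ) := by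
    rw [det_gram_eq b, Complex.star_def, ← Complex.normSq_eq_conj_mul_self]
    push_cast
    ring
  have hc : coords b ψ' i = fun l => inner ℂ (b l) φ := by
    ext l
    rw [coords_apply, hi]
  rw [successProb, hA, expectation_inputState_self, hψ'.2, hd, Complex.re_mul_ofReal, hc]

theorem normSq_det_coords_pos (b : OrthonormalBasis (Fin n) ℂ H) {ψ : Fin n → H}
    (hψ : LinearIndependent ℂ ψ) : 0 < Complex.normSq (coords b ψ).det := by
  have h : (gram ℂ ψ).det ≠ 0 := det_gram_ne_zero_iff_linearIndependent.mpr hψ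
  rw [det_gram_eq b] at h
  exact Complex.normSq_pos.mpr (right_ne_zero_of_mul h)

/-- The lower bound makes `A - c` positive, the diagonal makes its trace zero, and a positive matrix
with trace zero vanishes. -/
theorem eq_smul_one_of_le (b : OrthonormalBasis (Fin n) ℂ H) (hn : n ≠ 0)
    {A : Matrix (Fin n) (Fin n) ℂ} (hA : A.PosSemidef) {c : ℝ}
    (hle : ∀ φ : H, ‖φ‖ = 1 →
      c ≤ (star (fun l => inner ℂ (b l) φ) ⬝ᵥ A *ᵥ fun l => inner ℂ (b l) φ).re)
    (hdiag : ∀ k, (A k k).re = c) : A = (c : ℂ) • 1 := by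
  have hpos : (A - (c : ℂ) • 1).PosSemidef := by
    refine PosSemidef.of_dotProduct_mulVec_nonneg ?_ fun x => ?_
    · refine hA.isHermitian.sub ?_
      rw [IsHermitian, conjTranspose_smul, conjTranspose_one, Complex.star_def,
        Complex.conj_ofReal]
    · obtain ⟨s, u, hu, hs⟩ := exists_unit_smul b hn (b.repr.symm (WithLp.toLp 2 x))
      have hx : x = s • fun l => inner ℂ (b l) u := by
        ext l
        have h := b.repr_apply_apply (b.repr.symm (WithLp.toLp 2 x)) l
        rw [b.repr.apply_symm_apply] at h
        rw [Pi.smul_apply, smul_eq_mul, ← inner_smul_right, ← hs, ← h]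
      set y : Fin n → ℂ := fun l => inner ℂ (b l) u with hy
      have hyy : star y ⬝ᵥ y = 1 := by
        have h := star_coords_dotProduct_self b (fun _ : Fin 1 => u) 0
        rw [hu] at h
        refine h.trans ?_
        simp
      have hyA : (c : ℂ) ≤ star y ⬝ᵥ A *ᵥ y := by
        have h := Complex.le_def.mp (hA.dotProduct_mulVec_nonneg y)
        refine Complex.le_def.mpr ⟨hle u hu, ?_⟩
        rw [Complex.ofReal_im, ← h.2, Complex.zero_im]
      have : star x ⬝ᵥ (A - (c : ℂ) • 1) *ᵥ x = star s * s * (star y ⬝ᵥ A *ᵥ y - c) := by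
        rw [hx, star_smul, mulVec_smul, smul_dotProduct, dotProduct_smul, sub_mulVec, smul_mulVec,
          one_mulVec, dotProduct_sub, dotProduct_smul, hyy]
        simp only [smul_eq_mul]
        ring
      rw [this]
      exact mul_nonneg (star_mul_self_nonneg s) (sub_nonneg.mpr hyA)
  have htr : (A - (c : ℂ) • 1).trace = 0 := by
    refine Finset.sum_eq_zero fun k _ => ?_
    have h := Complex.le_def.mp (hA.diag_nonneg (i := k))
    apply Complex.ext
    · simp [hdiag]
    · simpa using h.2.symm
  exact sub_eq_zero.mp (hpos.trace_eq_zero_iff.mp htr)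

theorem successProb_optimalMeasurement_eq (b : OrthonormalBasis (Fin n) ℂ H) {ψ : Fin n → H}
    (hψ : ∀ i, ‖ψ i‖ = 1) (i : Fin n) :
    successProb b (optimalMeasurement b n) ψ i =
      (n : ℝ) / ((n : ℝ) + 1) * (Complex.normSq (coords b ψ).det / n.factorial) := by
  apply Complex.ofReal_injective
  rw [successProb_optimalMeasurement b hψ, det_gram_eq b, Complex.star_def,
    ← Complex.normSq_eq_conj_mul_self, Nat.factorial_succ]
  push_cast
  rw [div_mul_div_comm, div_mul_eq_mul_div]

theorem worstCaseOn_le_and_eq_of_eq (hn : 2 ≤ n) (b : OrthonormalBasis (Fin n) ℂ H)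
    {ψ : Fin n → H} (hψ : ψ ∈ independentStates H n) {P : Fin (n + 1) → TensOp n (n + 1)}
    (hP : IsUnambiguousDiscriminator b P) :
    worstCaseOn b P (statesWithGram H (gram ℂ ψ)) ≤
        worstCaseOn b (optimalMeasurement b n) (statesWithGram H (gram ℂ ψ)) ∧
      (worstCaseOn b P (statesWithGram H (gram ℂ ψ)) =
          worstCaseOn b (optimalMeasurement b n) (statesWithGram H (gram ℂ ψ)) →
        P = optimalMeasurement b n) := by
  have hn0 : n ≠ 0 := by omega
  have : Nontrivial (Fin n) := Fin.nontrivial_iff_two_le.mpr hn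
  choose A hA hPA using exists_eq_tensorAt hn0 b hP
  have hd : 0 < Complex.normSq (coords b ψ).det / n.factorial :=
    div_pos (normSq_det_coords_pos b hψ.2) (by exact_mod_cast n.factorial_pos)
  have hdiag : ∀ i k, worstCaseOn b P (statesWithGram H (gram ℂ ψ)) ≤
      (A i k k).re * (Complex.normSq (coords b ψ).det / n.factorial) := by
    intro i k
    have h := worstCaseOn_le_mul b hP hψ (hPA i) (b.orthonormal.1 k)
    have hk : (fun l => inner ℂ (b l) (b k)) = (Pi.single k 1 : Fin n → ℂ) := by
      ext l
      rw [orthonormal_iff_ite.mp b.orthonormal, Pi.single_apply]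
    rw [hk] at h
    simpa using h
  let i₀ : Fin n := ⟨0, by omega⟩
  rw [worstCaseOn_optimalMeasurement b hψ i₀, successProb_optimalMeasurement_eq b hψ.1]
  constructor
  -- A second outcome exists because `n ≥ 2`; the worst case is at most the average of the two
  -- bounds.
  · obtain ⟨j, hj⟩ := exists_ne i₀
    have h := mul_le_mul_of_nonneg_right
      (diag_add_diag_le hn0 b hP.isPOVM hPA hj i₀) hd.le
    linarith [hdiag i₀ i₀, hdiag j i₀]
  · intro heq
    rw [heq] at hdiag
    have hge : ∀ i k, (n : ℝ) / ((n : ℝ) + 1) ≤ (A i k k).re := fun i k =>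
      le_of_mul_le_mul_right (hdiag i k) hd
    have hsucc : ∀ i : Fin n, P i.succ = optimalMeasurement b n i.succ := by
      intro i
      have h1 : A i = (((n : ℝ) / ((n : ℝ) + 1) : ℝ) : ℂ) • 1 := by
        refine eq_smul_one_of_le b hn0 (hA i) (fun φ hφ => ?_) fun k => ?_
        · have h := worstCaseOn_le_mul b hP hψ (hPA i) hφ
          rw [heq] at h
          exact le_of_mul_le_mul_right h hd
        -- Both diagonal entries are at least `n/(n+1)` and their sum is at most twice that.
        · obtain ⟨j, hj⟩ := exists_ne i
          linarith [hge i k, hge j k, diag_add_diag_le hn0 b hP.isPOVM hPA hj k]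
      rw [hPA, h1, optimalMeasurement_succ, tensorAt_eq, tensorAt_eq, Matrix.mul_smul, smul_mul]
      push_cast
      rfl
    funext a
    refine Fin.cases ?_ hsucc a
    rw [optimalMeasurement_zero, ← hP.isPOVM.sum_eq_one, Fin.sum_univ_succ]
    simp_rw [hsucc]
    rw [add_sub_cancel_right]

theorem efficiency_le (hn : 2 ≤ n) (b : OrthonormalBasis (Fin n) ℂ H)
    {P : Fin (n + 1) → TensOp n (n + 1)} (hP : IsUnambiguousDiscriminator b P) :
    efficiency b P ≤ efficiency b (optimalMeasurement b n) := by
  let i₀ : Fin n := ⟨0, by omega⟩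
  -- The basis `b` itself is an independent family, so the set is nonempty. Each value for the
  -- optimal measurement is its worst case on one Gram class, where the previous bound applies.
  refine le_csInf ⟨_, b, ⟨b.orthonormal.1, b.orthonormal.linearIndependent⟩, i₀, rfl⟩ ?_
  rintro _ ⟨ψ, hψ, i, rfl⟩
  rw [← worstCaseOn_optimalMeasurement b hψ]
  refine le_trans ?_ (worstCaseOn_le_and_eq_of_eq hn b hψ hP).1
  refine csInf_le_csInf (bddBelow_successProb b hP _) ⟨_, ψ, ⟨hψ, rfl⟩, i, rfl⟩ ?_
  rintro _ ⟨ψ', hψ', j, rfl⟩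
  exact ⟨ψ', hψ'.1, j, rfl⟩

end ProgDisc

end

theorem theorem2 {H : Type*} [NormedAddCommGroup H] [InnerProductSpace ℂ H]
    (n : ℕ) (hn : 2 ≤ n) (b : OrthonormalBasis (Fin n) ℂ H) :
    -- the measurement is an unambiguous programmable discriminator
    ProgDisc.IsUnambiguousDiscriminator b (ProgDisc.optimalMeasurement b n) ∧
    -- its success probabilities
    (∀ ψ : Fin n → H, (∀ i, ‖ψ i‖ = 1) → ∀ i,
      ((ProgDisc.successProb b (ProgDisc.optimalMeasurement b n) ψ i : ℝ) : ℂ) =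
        (n : ℂ) / ((n + 1).factorial : ℂ) * (Matrix.gram ℂ ψ).det) ∧
    -- it maximizes the worst case over all linearly independent states
    (∀ P : Fin (n + 1) → ProgDisc.TensOp n (n + 1), ProgDisc.IsUnambiguousDiscriminator b P →
      ProgDisc.efficiency b P ≤ ProgDisc.efficiency b (ProgDisc.optimalMeasurement b n)) ∧
    -- for every Gram matrix of linearly independent states, it is the unique maximizer of the
    -- worst case over the states with this Gram matrix
    (∀ ψ ∈ ProgDisc.independentStates H n,
      ∀ P : Fin (n + 1) → ProgDisc.TensOp n (n + 1), ProgDisc.IsUnambiguousDiscriminator b P →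
        ProgDisc.worstCaseOn b P (ProgDisc.statesWithGram H (Matrix.gram ℂ ψ)) ≤
          ProgDisc.worstCaseOn b (ProgDisc.optimalMeasurement b n)
            (ProgDisc.statesWithGram H (Matrix.gram ℂ ψ)) ∧
        (ProgDisc.worstCaseOn b P (ProgDisc.statesWithGram H (Matrix.gram ℂ ψ)) =
            ProgDisc.worstCaseOn b (ProgDisc.optimalMeasurement b n)
              (ProgDisc.statesWithGram H (Matrix.gram ℂ ψ)) →
          P = ProgDisc.optimalMeasurement b n)) :=
  ⟨ProgDisc.isUnambiguousDiscriminator_optimalMeasurement (by omega) b,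
    fun _ hψ i => ProgDisc.successProb_optimalMeasurement b hψ i,
    fun _ hP => ProgDisc.efficiency_le hn b hP,
    fun _ hψ _ hP => ProgDisc.worstCaseOn_le_and_eq_of_eq hn b hψ hP⟩
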